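/- Throughout, all spaces are real. A linear subspace $R$ of a Banach space $E$ is an operator range in $E$ if there exist a Banach space $G$ and a bounded linear operator $A:G\to E$ with $A(G)=R$; $\operatorname{codim}_E V$ denotes the algebraic dimension of $E/V$ for a (not necessarily closed) linear subspace $V\subset E$; and, for a closed subspace $L\subset E$, $Q_L:E\to E/L$ is the canonical quotient map onto $E/L$ with the quotient norm. A bounded linear operator $T:E\to F$ between Banach spaces has the Kato property for a closed subspace $L\subset E$ if for every closed finite-codimensional subspace $W\subset E$ with $L\subset W$ and every $\varepsilon>0$ there exists $u\in W\setminus L$ such that $\|T(u)\|\le\varepsilon\|Q_L(u)\|$. Theorem 3.1. Let $E$ and $F$ be Banach spaces, let $L\subset E$ be a closed subspace, let $T:E\to F$ be a bounded linear operator with the Kato property for $L$, and let $R\neq E$ be a dense operator range in $E$. If $\operatorname{codim}_E(L+R)=\infty$, then there exists a closed subspace $E_1\subset E$ such that (a) $L\subset E_1$; (b) $E/E_1$ is separable and infinite-dimensional; (c) $\operatorname{codim}_E(E_1+R)=\infty$; (d) $\overline{T(E_1)}=\overline{T(E)}$. -/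

import Mathlib

universe u v

/-- `V` has infinite codimension in `E`: the algebraic quotient `E ⧸ V` is infinite-dimensional.
The subspace `V` need not be closed. -/
def InfiniteCodim {E : Type u} [AddCommGroup E] [Module ℝ E] (V : Submodule ℝ E) : Prop :=
  ¬ FiniteDimensional ℝ (E ⧸ V)

/-- `R` is an operator range in `E`: there are a Banach space `G` and a bounded linear operator
`A : G → E` with `A(G) = R`. Letting `G` live in the universe of `E` is no restriction, because
`G` may be replaced by `G / ker A`, which is in bijection with `R`. -/
def IsOperatorRange {E : Type u} [NormedAddCommGroup E] [NormedSpace ℝ E]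
    (R : Submodule ℝ E) : Prop :=
  ∃ (G : Type u) (_ : NormedAddCommGroup G) (_ : NormedSpace ℝ G) (_ : CompleteSpace G)
    (A : G →L[ℝ] E), Set.range A = (R : Set E)

/-- The class of proper dense operator ranges of `E`. -/
structure IsProperDenseOperatorRange {E : Type u} [NormedAddCommGroup E] [NormedSpace ℝ E]
    (R : Submodule ℝ E) : Prop where
  isOperatorRange : IsOperatorRange R
  dense : Dense (R : Set E)
  ne_top : R ≠ ⊤

/-- `T` has the Kato property for `L`: every closed finite-codimensional subspace `W ⊇ L`
contains, for every `ε > 0`, some `x ∉ L` with `‖T x‖ ≤ ε ‖Q_L x‖`, where `Q_L : E → E ⧸ L` is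
the quotient map and `E ⧸ L` has the quotient norm. -/
def HasKatoPropertyFor {E : Type u} {F : Type v} [NormedAddCommGroup E] [NormedSpace ℝ E]
    [NormedAddCommGroup F] [NormedSpace ℝ F] (T : E →L[ℝ] F) (L : Submodule ℝ E) : Prop :=
  ∀ W : Submodule ℝ E, IsClosed (W : Set E) → FiniteDimensional ℝ (E ⧸ W) → L ≤ W →
    ∀ ε : ℝ, 0 < ε → ∃ x ∈ W, x ∉ L ∧ ‖T x‖ ≤ ε * ‖L.mkQ x‖

/-! Build a biorthogonal system of pairs `(x j, f j)` and `(y j, g j)`, all functionals vanishing on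
`L`, with `x j` and `g j` in the unit balls, `f j` tiny along `A` and `T (y j)` tiny. Infinite
codimension of `L + R` yields the `f j`: otherwise, for some finite-dimensional `V`, the map from
`G` to `E / (L + V)` would have an adjoint bounded below and be onto. The Kato property and a
norming functional on `E / L` yield the `y j` and `g j`.

Split ℕ into infinite rows by `Nat.unpair`, and let `E₁` be the common kernel of `φ j = f j + ∑ 8⁻ⁿ
g n`, with `n` in row `j`. On `R` the values `φ j` decay like `4⁻ʲ`, so expansions in the `x j`
converge and `E₁ + span x` is dense; this gives separability. The sums of `2⁻ᵏ x k` over the rows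
have coefficients that decay too slowly, so they are independent modulo `E₁ + R`. Finally `x j - 8ⁿ
y n ∈ E₁` for `n` in row `j`, while `8ⁿ T (y n) → 0`; hence `T (x j)` is in the closure of `T(E₁)`,
and density finishes. -/

open Filter Topology

/-! ### Surjectivity by duality -/

/-- If the adjoint of a bounded operator between Banach spaces is bounded below, then the operator
is surjective. -/
theorem ContinuousLinearMap.surjective_of_forall_norm_le_comp {G X : Type*}
    [NormedAddCommGroup G] [NormedSpace ℝ G] [CompleteSpace G]
    [NormedAddCommGroup X] [NormedSpace ℝ X]
    (A : G →L[ℝ] X) {δ : ℝ} (hδ : 0 < δ)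
    (hA : ∀ f : X →L[ℝ] ℝ, δ * ‖f‖ ≤ ‖f.comp A‖) : Function.Surjective A := by
  have approx : ∀ y : X, ∃ x : G, ‖y - A x‖ ≤ 1 / 2 * ‖y‖ ∧ ‖x‖ ≤ δ⁻¹ * ‖y‖ := by
    intro y
    rcases eq_or_ne y 0 with rfl | hy
    · exact ⟨0, by simp, by simp⟩
    have hy' : 0 < ‖y‖ := norm_pos_iff.2 hy
    have hρ : 0 < δ⁻¹ * ‖y‖ := by positivity
    have hmem : y ∈ closure (A '' Metric.closedBall 0 (δ⁻¹ * ‖y‖)) := by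
      by_contra hnot
      obtain ⟨f, c, hlt, hc⟩ := geometric_hahn_banach_closed_point
        ((convex_closedBall (0 : G) (δ⁻¹ * ‖y‖)).linear_image A.toLinearMap).closure
        isClosed_closure hnot
      have hball : ∀ z ∈ Metric.closedBall (0 : G) (δ⁻¹ * ‖y‖), f (A z) ≤ c := fun z hz =>
        (hlt _ (subset_closure ⟨z, hz, rfl⟩)).le
      have hnorm : ‖f.comp A‖ ≤ c / (δ⁻¹ * ‖y‖) := by
        refine ContinuousLinearMap.opNorm_bound_of_ball_bound hρ c _ fun z hz => ?_
        refine abs_le.2 ⟨?_, hball z hz⟩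
        have := hball (-z) (by simpa using hz)
        simp only [map_neg] at this
        simp only [ContinuousLinearMap.comp_apply]
        linarith
      have h₁ := (hA f).trans hnorm
      rw [le_div_iff₀ hρ] at h₁
      have h₂ : δ * ‖f‖ * (δ⁻¹ * ‖y‖) = ‖f‖ * ‖y‖ := by field_simp
      have h₃ := (le_abs_self _).trans (f.le_opNorm y)
      linarith
    obtain ⟨_, ⟨x, hx, rfl⟩, hd⟩ := Metric.mem_closure_iff.1 hmem (1 / 2 * ‖y‖) (by positivity)
    exact ⟨x, by simpa [dist_eq_norm] using hd.le, by simpa using hx⟩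
  choose g hg hgn using approx
  intro y
  -- Iterating the residual halves it each time, so the corrections sum to an exact preimage.
  let h : X → X := fun y => y - A (g y)
  have hnle : ∀ n : ℕ, ‖h^[n] y‖ ≤ (1 / 2) ^ n * ‖y‖ := by
    intro n
    induction n with
    | zero => simp
    | succ n ih =>
      rw [Function.iterate_succ_apply']
      refine (hg _).trans ?_
      rw [pow_succ', mul_assoc]
      gcongr
  let w : ℕ → G := fun n => g (h^[n] y)
  have hw : ∀ n, ‖w n‖ ≤ (1 / 2) ^ n * (δ⁻¹ * ‖y‖) := fun n =>
    (hgn _).trans <| by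
      calc δ⁻¹ * ‖h^[n] y‖ ≤ δ⁻¹ * ((1 / 2) ^ n * ‖y‖) := by gcongr; exact hnle n
        _ = _ := by ring
  have hsum : Summable w :=
    Summable.of_norm_bounded (summable_geometric_two.mul_right _) hw
  refine ⟨∑' n, w n, ?_⟩
  have hpartial : ∀ n, A (∑ i ∈ Finset.range n, w i) = y - h^[n] y := by
    intro n
    induction n with
    | zero => simp
    | succ n ih =>
      rw [Finset.sum_range_succ, map_add, ih, Function.iterate_succ_apply']
      simp only [h, w]
      abel
  have h₁ : Filter.Tendsto (fun n => A (∑ i ∈ Finset.range n, w i)) Filter.atTop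
      (nhds (A (∑' n, w n))) :=
    (A.continuous.tendsto _).comp hsum.hasSum.tendsto_sum_nat
  have h₂ : Filter.Tendsto (fun n => h^[n] y) Filter.atTop (nhds 0) := by
    refine squeeze_zero_norm hnle ?_
    simpa using (tendsto_pow_atTop_nhds_zero_of_lt_one (by norm_num : (0 : ℝ) ≤ 1 / 2)
      (by norm_num)).mul_const ‖y‖
  simp only [hpartial] at h₁
  have h₃ := h₂.const_sub y
  rw [sub_zero] at h₃
  exact tendsto_nhds_unique h₁ h₃

/-- If a closed subspace `M` and an operator range do not span the whole space, then some functional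
vanishing on `M` is arbitrarily small on the operator range. -/
theorem exists_functional_norm_comp_lt {G X : Type*}
    [NormedAddCommGroup G] [NormedSpace ℝ G] [CompleteSpace G]
    [NormedAddCommGroup X] [NormedSpace ℝ X]
    (A : G →L[ℝ] X) {M : Submodule ℝ X} (hM : IsClosed (M : Set X))
    (hMA : M ⊔ A.toLinearMap.range ≠ ⊤) {δ : ℝ} (hδ : 0 < δ) :
    ∃ f : X →L[ℝ] ℝ, (∀ x ∈ M, f x = 0) ∧ ‖f.comp A‖ < δ * ‖f‖ := by
  have : IsClosed (M : Set X) := hM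
  by_contra! hcon
  have hsurj : Function.Surjective (M.mkQL.comp A) := by
    refine ContinuousLinearMap.surjective_of_forall_norm_le_comp _ hδ fun f => ?_
    have h₁ := hcon (f.comp M.mkQL) fun x hx => by
      simp [(Submodule.Quotient.mk_eq_zero M).2 hx]
    have h₂ : ‖f‖ ≤ ‖f.comp M.mkQL‖ := by
      refine f.opNorm_le_bound (norm_nonneg _) fun q => ?_
      refine le_of_forall_pos_le_add fun ε hε => ?_
      obtain ⟨x, rfl, hx⟩ := Submodule.Quotient.norm_mk_lt (S := M) q
        (ε := ε / (‖f.comp M.mkQL‖ + 1)) (by positivity)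
      calc ‖f (Submodule.Quotient.mk x)‖ = ‖(f.comp M.mkQL) x‖ := rfl
        _ ≤ ‖f.comp M.mkQL‖ * ‖x‖ := ContinuousLinearMap.le_opNorm _ _
        _ ≤ ‖f.comp M.mkQL‖ * (‖(Submodule.Quotient.mk x : X ⧸ M)‖ +
            ε / (‖f.comp M.mkQL‖ + 1)) := by gcongr
        _ = ‖f.comp M.mkQL‖ * ‖(Submodule.Quotient.mk x : X ⧸ M)‖ +
            ‖f.comp M.mkQL‖ / (‖f.comp M.mkQL‖ + 1) * ε := by ring
        _ ≤ ‖f.comp M.mkQL‖ * ‖(Submodule.Quotient.mk x : X ⧸ M)‖ + 1 * ε := by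
          gcongr
          exact (div_le_one (by positivity)).2 (by linarith)
        _ = _ := by rw [one_mul]
    calc δ * ‖f‖ ≤ δ * ‖f.comp M.mkQL‖ := by gcongr
      _ ≤ _ := h₁
  refine hMA (eq_top_iff.2 fun x _ => ?_)
  obtain ⟨z, hz⟩ := hsurj (M.mkQ x)
  have hz' : x - A z ∈ M := (Submodule.Quotient.eq M).1 hz.symm
  have := Submodule.add_mem_sup hz' (LinearMap.mem_range_self A.toLinearMap z)
  simpa using this

/-! ### Construction of biorthogonal systems -/

/-- Sequences can be built by choosing each term in terms of the previous ones. -/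
theorem exists_seq_of_forall_exists_extension {α : Type*} [Nonempty α]
    (Q : ℕ → (ℕ → α) → α → Prop)
    (hcongr : ∀ n s s' a, (∀ m < n, s m = s' m) → Q n s a → Q n s' a)
    (hstep : ∀ n s, (∀ m < n, Q m s (s m)) → ∃ a, Q n s a) :
    ∃ s : ℕ → α, ∀ n, Q n s (s n) := by
  choose! a ha using hstep
  -- Only the first `n` entries of `S n` matter; the rest stay arbitrary, which `hcongr` makes
  -- harmless.
  let S : ℕ → ℕ → α := fun n => Nat.rec (fun _ => Classical.arbitrary α) (fun n s => Function.update s n (a n s)) n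
  have hS : ∀ n, S (n + 1) = Function.update (S n) n (a n (S n)) := fun _ => rfl
  have hstable : ∀ m k, S (m + 1 + k) m = S (m + 1) m := by
    intro m k
    induction k with
    | zero => rfl
    | succ k ih =>
      rw [← ih, ← add_assoc, hS, Function.update_of_ne (by omega)]
  have hagree : ∀ n, ∀ m < n, S n m = S (m + 1) m := by
    intro n m hm
    obtain ⟨k, rfl⟩ := Nat.exists_eq_add_of_le (Nat.succ_le_of_lt hm)
    exact hstable m k
  have key : ∀ n, Q n (fun m => S (m + 1) m) (S (n + 1) n) := by
    intro n
    induction n using Nat.strong_induction_on with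
    | _ n ih =>
      have h₁ : Q n (S n) (a n (S n)) := by
        refine ha n (S n) fun m hm => ?_
        rw [hagree n m hm]
        exact hcongr m _ _ _ (fun i hi => (hagree n i (hi.trans hm)).symm) (ih m hm)
      have h₂ : S (n + 1) n = a n (S n) := by rw [hS, Function.update_self]
      rw [h₂]
      exact hcongr n _ _ _ (fun i hi => hagree n i hi) h₁
  exact ⟨_, key⟩

/-- The projection along the first `n` terms of a biorthogonal system `(e i, φ i)`. -/
noncomputable def biorthogonalProj {E : Type*} [NormedAddCommGroup E] [NormedSpace ℝ E]
    (e : ℕ → E) (φ : ℕ → E →L[ℝ] ℝ) (n : ℕ) : E →L[ℝ] E :=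
  ContinuousLinearMap.id ℝ E - ∑ i ∈ Finset.range n, (φ i).smulRight (e i)

section Biorthogonal

variable {E : Type*} [NormedAddCommGroup E] [NormedSpace ℝ E]
  {e : ℕ → E} {φ : ℕ → E →L[ℝ] ℝ} {n : ℕ}

theorem biorthogonalProj_apply (x : E) :
    biorthogonalProj e φ n x = x - ∑ i ∈ Finset.range n, φ i x • e i := by
  simp [biorthogonalProj]

theorem apply_biorthogonalProj (h : ∀ i < n, ∀ j < n, φ i (e j) = if i = j then 1 else 0)
    {i : ℕ} (hi : i < n) (x : E) : φ i (biorthogonalProj e φ n x) = 0 := by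
  rw [biorthogonalProj_apply, map_sub, map_sum, Finset.sum_eq_single i]
  · simp [h i hi i hi]
  · intro j hj hne
    simp [h i hi j (Finset.mem_range.1 hj), hne.symm]
  · intro hn
    exact absurd (Finset.mem_range.2 hi) hn

theorem biorthogonalProj_basis (h : ∀ i < n, ∀ j < n, φ i (e j) = if i = j then 1 else 0)
    {i : ℕ} (hi : i < n) : biorthogonalProj e φ n (e i) = 0 := by
  rw [biorthogonalProj_apply, Finset.sum_eq_single i]
  · simp [h i hi i hi]
  · intro j hj hne
    simp [h j (Finset.mem_range.1 hj) i hi, hne]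
  · intro hn
    exact absurd (Finset.mem_range.2 hi) hn

theorem biorthogonalProj_of_forall_eq_zero {x : E} (hx : ∀ i < n, φ i x = 0) :
    biorthogonalProj e φ n x = x := by
  rw [biorthogonalProj_apply, Finset.sum_eq_zero, sub_zero]
  intro i hi
  rw [hx i (Finset.mem_range.1 hi), zero_smul]

end Biorthogonal

/-- A finite biorthogonal system can be extended by a vector in the unit ball and a functional which
is small on the image of the unit ball under `A`. -/
theorem exists_biorthogonal_extension_small_comp {E G : Type*}
    [NormedAddCommGroup E] [NormedSpace ℝ E]
    [NormedAddCommGroup G] [NormedSpace ℝ G] [CompleteSpace G]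
    {L : Submodule ℝ E} (hL : IsClosed (L : Set E)) (A : G →L[ℝ] E)
    (hLA : InfiniteCodim (L ⊔ A.toLinearMap.range))
    {e : ℕ → E} {φ : ℕ → E →L[ℝ] ℝ} {n : ℕ}
    (h : ∀ i < n, ∀ j < n, φ i (e j) = if i = j then 1 else 0)
    {δ : ℝ} (hδ : 0 < δ) :
    ∃ (x : E) (f : E →L[ℝ] ℝ), (∀ l ∈ L, f l = 0) ∧ (∀ i < n, φ i x = 0) ∧
      (∀ i < n, f (e i) = 0) ∧ f x = 1 ∧ ‖x‖ ≤ 1 ∧ ‖f.comp A‖ ≤ δ := by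
  let V : Submodule ℝ E := Submodule.span ℝ (e '' Set.Iio n)
  have hV : FiniteDimensional ℝ V :=
    FiniteDimensional.span_of_finite ℝ ((Set.finite_Iio n).image e)
  have htop : (L ⊔ V) ⊔ A.toLinearMap.range ≠ ⊤ := by
    intro htop
    refine hLA ?_
    let q := (L ⊔ A.toLinearMap.range).mkQ
    have : FiniteDimensional ℝ (V.map q) := inferInstance
    -- A finite-dimensional `V` cannot fill an infinite-dimensional quotient.
    have hmap : V.map q = ⊤ := by
      have h₁ : (L ⊔ A.toLinearMap.range).map q = ⊥ := Submodule.mkQ_map_self _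
      have h₂ : (⊤ : Submodule ℝ E).map q = ⊤ := by simp [q]
      rw [← h₂, ← htop, sup_right_comm, Submodule.map_sup _ V, h₁, bot_sup_eq]
    rw [hmap] at this
    exact Submodule.topEquiv.finiteDimensional
  obtain ⟨f, hfM, hf⟩ := exists_functional_norm_comp_lt A
    (Submodule.isClosed_sup_finiteDimensional L V hL) htop
    -- The 2 pays for a vector that only half-norms `f`, the other factor for projecting it.
    (δ := δ / (2 * (‖biorthogonalProj e φ n‖ + 1))) (by positivity)
  have hfe : ∀ i < n, f (e i) = 0 := fun i hi =>
    hfM _ (Submodule.mem_sup_right (Submodule.subset_span ⟨i, hi, rfl⟩))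
  set P := biorthogonalProj e φ n with hP
  set C := ‖P‖ + 1 with hC
  have hC0 : 0 < C := by positivity
  have hf0 : 0 < ‖f‖ := by
    by_contra hn
    have h0 : ‖f‖ = 0 := le_antisymm (not_lt.1 hn) (norm_nonneg _)
    rw [h0, mul_zero] at hf
    exact absurd (norm_nonneg _) (not_le.2 hf)
  obtain ⟨x₀, hx₀, hfx⟩ : ∃ x₀ : E, ‖x₀‖ < 1 ∧ ‖f‖ / 2 < ‖f x₀‖ :=
    f.exists_lt_apply_of_lt_opNorm (half_lt_self hf0)
  have hfP : f (P x₀) = f x₀ := by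
    rw [hP, biorthogonalProj_apply, map_sub, map_sum, Finset.sum_eq_zero, sub_zero]
    intro i hi
    rw [map_smul, hfe i (Finset.mem_range.1 hi), smul_zero]
  have hfx0 : 0 < ‖f x₀‖ := (by positivity : 0 < ‖f‖ / 2).trans hfx
  have hfx0' : f x₀ ≠ 0 := norm_pos_iff.1 hfx0
  refine ⟨C⁻¹ • P x₀, (C / f x₀) • f, ?_, ?_, ?_, ?_, ?_, ?_⟩
  · intro l hl
    simp [hfM l (Submodule.mem_sup_left hl)]
  · intro i hi
    rw [map_smul, hP, apply_biorthogonalProj h hi, smul_zero]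
  · intro i hi
    simp [hfe i hi]
  · simp only [smul_apply, map_smul, hfP, smul_eq_mul]
    field_simp
  · rw [norm_smul, norm_inv, Real.norm_of_nonneg hC0.le, inv_mul_le_iff₀ hC0, mul_one]
    calc ‖P x₀‖ ≤ ‖P‖ * ‖x₀‖ := P.le_opNorm _
      _ ≤ ‖P‖ * 1 := by gcongr
      _ ≤ C := by rw [hC]; linarith
  · rw [ContinuousLinearMap.smul_comp, norm_smul, norm_div, Real.norm_of_nonneg hC0.le,
      div_mul_eq_mul_div, div_le_iff₀ hfx0]
    calc C * ‖f.comp A‖ ≤ C * (δ / (2 * C) * ‖f‖) := by gcongr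
      _ = δ * (‖f‖ / 2) := by field_simp
      _ ≤ δ * ‖f x₀‖ := by gcongr

/-- Under the Kato property, a finite biorthogonal system can be extended by a functional in the
unit ball and a vector with small image under `T`. -/
theorem HasKatoPropertyFor.exists_biorthogonal_extension {E : Type u} {F : Type v}
    [NormedAddCommGroup E] [NormedSpace ℝ E] [NormedAddCommGroup F] [NormedSpace ℝ F]
    {L : Submodule ℝ E} (hL : IsClosed (L : Set E)) {T : E →L[ℝ] F}
    (hT : HasKatoPropertyFor T L)
    {e : ℕ → E} {φ : ℕ → E →L[ℝ] ℝ} {n : ℕ} (hφL : ∀ i < n, ∀ l ∈ L, φ i l = 0)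
    (h : ∀ i < n, ∀ j < n, φ i (e j) = if i = j then 1 else 0)
    {δ : ℝ} (hδ : 0 < δ) :
    ∃ (x : E) (f : E →L[ℝ] ℝ), (∀ l ∈ L, f l = 0) ∧ (∀ i < n, φ i x = 0) ∧
      (∀ i < n, f (e i) = 0) ∧ f x = 1 ∧ ‖f‖ ≤ 1 ∧ ‖T x‖ ≤ δ := by
  have : IsClosed (L : Set E) := hL
  let Φ : E →L[ℝ] (Fin n → ℝ) := ContinuousLinearMap.pi fun i => φ i
  set P := biorthogonalProj e φ n with hP
  set C := ‖P‖ + 1 with hC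
  have hC0 : 0 < C := by positivity
  have hW : FiniteDimensional ℝ (E ⧸ Φ.toLinearMap.ker) :=
    (Φ.toLinearMap.quotKerEquivRange).symm.finiteDimensional
  obtain ⟨x, hxW, hxL, hTx⟩ := hT Φ.toLinearMap.ker Φ.isClosed_ker hW
    (fun l hl => by
      rw [LinearMap.mem_ker]
      ext i
      exact hφL i i.2 l hl) (δ / C) (by positivity)
  have hφx : ∀ i < n, φ i x = 0 := fun i hi => congrFun (LinearMap.mem_ker.1 hxW) ⟨i, hi⟩
  have hPx : P x = x := biorthogonalProj_of_forall_eq_zero hφx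
  set q := ‖L.mkQ x‖ with hq
  have hq0 : 0 < q :=
    norm_pos_iff.2 fun h0 => hxL ((Submodule.Quotient.mk_eq_zero L).1 h0)
  obtain ⟨g, hg1, hgx⟩ := exists_dual_vector'' ℝ (L.mkQ x)
  have hgx' : g (L.mkQ x) = q := hgx
  have hmk : ‖L.mkQL‖ ≤ 1 := ContinuousLinearMap.opNorm_le_bound _ zero_le_one fun y => by
    rw [one_mul]
    exact Submodule.Quotient.norm_mk_le L y
  -- Composing with `P` kills the `e i` but may raise the norm to `C`; moving `C` onto the vector is
  -- paid for by the `δ / C` above.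
  refine ⟨(C / q) • x, C⁻¹ • (g.comp (L.mkQL.comp P)), ?_, ?_, ?_, ?_, ?_, ?_⟩
  · intro l hl
    have hPl : P l = l := biorthogonalProj_of_forall_eq_zero fun i hi => hφL i hi l hl
    simp [hPl, (Submodule.Quotient.mk_eq_zero L).2 hl]
  · intro i hi
    rw [map_smul, hφx i hi, smul_zero]
  · intro i hi
    have hPe : P (e i) = 0 := biorthogonalProj_basis h hi
    simp [hPe]
  · have : g (L.mkQL (P x)) = q := by rw [hPx]; exact hgx'
    simp only [smul_apply, map_smul, ContinuousLinearMap.comp_apply, this,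
      smul_eq_mul]
    field_simp
  · rw [norm_smul, norm_inv, Real.norm_of_nonneg hC0.le, inv_mul_le_iff₀ hC0, mul_one]
    calc ‖g.comp (L.mkQL.comp P)‖ ≤ ‖g‖ * (‖L.mkQL‖ * ‖P‖) :=
          (ContinuousLinearMap.opNorm_comp_le _ _).trans
            (by gcongr; exact ContinuousLinearMap.opNorm_comp_le _ _)
      _ ≤ 1 * (1 * ‖P‖) := by gcongr
      _ ≤ C := by rw [hC]; linarith
  · rw [map_smul, norm_smul, norm_div, Real.norm_of_nonneg hC0.le, Real.norm_of_nonneg hq0.le]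
    calc C / q * ‖T x‖ ≤ C / q * (δ / C * q) := by gcongr
      _ = δ := by field_simp

/-- A biorthogonal system of functionals `f j, g j` vanishing on `L` and vectors `x j, y j`, with
`f j` small on the image of the unit ball under `A` and `T (y j)` small. -/
theorem HasKatoPropertyFor.exists_biorthogonal_sequences {E : Type u} {F : Type v} {G : Type*}
    [NormedAddCommGroup E] [NormedSpace ℝ E] [NormedAddCommGroup F] [NormedSpace ℝ F]
    [NormedAddCommGroup G] [NormedSpace ℝ G] [CompleteSpace G]
    {L : Submodule ℝ E} (hL : IsClosed (L : Set E)) {T : E →L[ℝ] F}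
    (hT : HasKatoPropertyFor T L) (A : G →L[ℝ] E)
    (hLA : InfiniteCodim (L ⊔ A.toLinearMap.range)) {δ : ℕ → ℝ} (hδ : ∀ n, 0 < δ n) :
    ∃ (x y : ℕ → E) (f g : ℕ → E →L[ℝ] ℝ),
      (∀ i, ∀ l ∈ L, f i l = 0) ∧ (∀ i, ∀ l ∈ L, g i l = 0) ∧
      (∀ i j, f i (x j) = if i = j then 1 else 0) ∧ (∀ i j, f i (y j) = 0) ∧
      (∀ i j, g i (x j) = 0) ∧ (∀ i j, g i (y j) = if i = j then 1 else 0) ∧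
      (∀ i, ‖x i‖ ≤ 1) ∧ (∀ i, ‖(f i).comp A‖ ≤ δ i) ∧
      (∀ i, ‖g i‖ ≤ 1) ∧ (∀ i, ‖T (y i)‖ ≤ δ i) := by
  -- Even indices produce the pairs `(x, f)`, odd ones the pairs `(y, g)`.
  obtain ⟨s, hs⟩ := exists_seq_of_forall_exists_extension (α := E × (E →L[ℝ] ℝ))
    (fun n s a => (∀ l ∈ L, a.2 l = 0) ∧ (∀ i < n, (s i).2 a.1 = 0) ∧
      (∀ i < n, a.2 (s i).1 = 0) ∧ a.2 a.1 = 1 ∧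
      (∀ k, n = 2 * k → ‖a.1‖ ≤ 1 ∧ ‖a.2.comp A‖ ≤ δ k) ∧
      (∀ k, n = 2 * k + 1 → ‖a.2‖ ≤ 1 ∧ ‖T a.1‖ ≤ δ k))
    (by
      rintro n s s' a hss ⟨h₁, h₂, h₃, h₄⟩
      exact ⟨h₁, fun i hi => hss i hi ▸ h₂ i hi, fun i hi => hss i hi ▸ h₃ i hi, h₄⟩)
    (by
      intro n s hs
      have hbi : ∀ i < n, ∀ j < n, (s i).2 (s j).1 = if i = j then 1 else 0 := by
        intro i hi j hj
        rcases lt_trichotomy i j with hij | rfl | hij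
        · rw [if_neg hij.ne, (hs j hj).2.1 i hij]
        · rw [if_pos rfl, (hs i hi).2.2.2.1]
        · rw [if_neg hij.ne', (hs i hi).2.2.1 j hij]
      rcases Nat.even_or_odd' n with ⟨k, rfl | rfl⟩
      · obtain ⟨x, f, h₁, h₂, h₃, h₄, h₅, h₆⟩ := exists_biorthogonal_extension_small_comp
          (e := fun i => (s i).1) (φ := fun i => (s i).2) hL A hLA hbi (hδ k)
        refine ⟨(x, f), h₁, h₂, h₃, h₄, fun k' hk' => ?_, fun k' hk' => by omega⟩
        obtain rfl : k = k' := by omega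
        exact ⟨h₅, h₆⟩
      · obtain ⟨x, f, h₁, h₂, h₃, h₄, h₅, h₆⟩ := hT.exists_biorthogonal_extension
          (e := fun i => (s i).1) (φ := fun i => (s i).2) hL (fun i hi => (hs i hi).1) hbi (hδ k)
        refine ⟨(x, f), h₁, h₂, h₃, h₄, fun k' hk' => by omega, fun k' hk' => ?_⟩
        obtain rfl : k = k' := by omega
        exact ⟨h₅, h₆⟩)
  have hbi : ∀ i j, (s i).2 (s j).1 = if i = j then 1 else 0 := by
    intro i j
    rcases lt_trichotomy i j with hij | rfl | hij
    · rw [if_neg hij.ne, (hs j).2.1 i hij]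
    · rw [if_pos rfl, (hs i).2.2.2.1]
    · rw [if_neg hij.ne', (hs i).2.2.1 j hij]
  refine ⟨fun i => (s (2 * i)).1, fun i => (s (2 * i + 1)).1, fun i => (s (2 * i)).2,
    fun i => (s (2 * i + 1)).2, fun i => (hs _).1, fun i => (hs _).1, ?_, ?_, ?_, ?_,
    fun i => ((hs _).2.2.2.2.1 i rfl).1, fun i => ((hs _).2.2.2.2.1 i rfl).2,
    fun i => ((hs _).2.2.2.2.2 i rfl).1, fun i => ((hs _).2.2.2.2.2 i rfl).2⟩
  all_goals
    intro i j
    rw [hbi]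
  · simp
  · exact if_neg (by omega)
  · exact if_neg (by omega)
  · simp


/-! ### Common kernels and perturbed functionals -/

section

variable {E : Type*} [NormedAddCommGroup E] [NormedSpace ℝ E] {x : ℕ → E} {φ : ℕ → E →L[ℝ] ℝ}

/-- The intersection of the kernels of a sequence of functionals, together with the vectors of a
biorthogonal sequence, spans a dense subspace as soon as biorthogonal expansions converge on a dense
subspace. -/
theorem dense_iInf_ker_sup_span [CompleteSpace E]
    (hφx : ∀ i j, φ i (x j) = if i = j then 1 else 0) {R : Submodule ℝ E} (hR : Dense (R : Set E))
    (hsum : ∀ r ∈ R, Summable fun k => φ k r • x k) :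
    Dense (((⨅ k, (φ k).toLinearMap.ker) ⊔ Submodule.span ℝ (Set.range x) : Submodule ℝ E) :
      Set E) := by
  refine dense_closure.1 (hR.mono fun r hr => ?_)
  have hs := hsum r hr
  refine mem_closure_of_tendsto (b := atTop)
    (f := fun n => (r - ∑' k, φ k r • x k) + ∑ k ∈ Finset.range n, φ k r • x k) ?_ ?_
  · simpa using hs.hasSum.tendsto_sum_nat.const_add (r - ∑' k, φ k r • x k)
  · refine Eventually.of_forall fun n => Submodule.add_mem_sup ?_ ?_
    · simp only [Submodule.mem_iInf, LinearMap.mem_ker]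
      intro i
      change φ i _ = 0
      rw [map_sub, (φ i).map_tsum hs, tsum_eq_single i]
      · simp [hφx]
      · intro j hj
        simp [hφx, hj.symm]
    · exact Submodule.sum_mem _ fun k _ =>
        Submodule.smul_mem _ _ (Submodule.subset_span ⟨k, rfl⟩)

theorem separableSpace_quotient_of_dense_sup_span {M : Submodule ℝ E}
    (hM : Dense ((M ⊔ Submodule.span ℝ (Set.range x) : Submodule ℝ E) : Set E)) :
    TopologicalSpace.SeparableSpace (E ⧸ M) := by
  have hsep : TopologicalSpace.IsSeparable
      (Submodule.span ℝ (Set.range fun k => M.mkQ (x k)) : Set (E ⧸ M)) :=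
    (Set.countable_range _).isSeparable.span
  have hdense : Dense (Submodule.span ℝ (Set.range fun k => M.mkQ (x k)) : Set (E ⧸ M)) := by
    have h := (Submodule.mkQ_surjective M).denseRange.dense_image M.mkQL.continuous hM
    refine h.mono ?_
    rintro _ ⟨z, hz, rfl⟩
    have h₁ : M.mkQ z ∈ (M ⊔ Submodule.span ℝ (Set.range x)).map M.mkQ := ⟨z, hz, rfl⟩
    rw [Submodule.map_sup, Submodule.mkQ_map_self, bot_sup_eq, Submodule.map_span,
      ← Set.range_comp] at h₁
    exact h₁
  rw [← TopologicalSpace.isSeparable_univ_iff, ← hdense.closure_eq]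
  exact hsep.closure

/-- If the functionals `φ k` decay fast on `R`, then the intersection of their kernels together
with `R` has infinite codimension. -/
theorem infiniteCodim_iInf_ker_sup [CompleteSpace E]
    (hφx : ∀ i j, φ i (x j) = if i = j then 1 else 0) (hx : ∀ k, ‖x k‖ ≤ 1) {R : Submodule ℝ E}
    (hdecay : ∀ r ∈ R, ∃ K : ℝ, ∀ k, |φ k r| ≤ K * (1 / 4) ^ k) :
    InfiniteCodim ((⨅ k, (φ k).toLinearMap.ker) ⊔ R) := by
  intro hfin
  let c : ℕ → ℕ → ℝ := fun j k => if k.unpair.1 = j then (1 / 2) ^ k else 0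
  let y : ℕ → E := fun j => ∑' k, c j k • x k
  have hs : ∀ j, Summable fun k => c j k • x k := fun j => by
    refine Summable.of_norm_bounded summable_geometric_two fun k => ?_
    rw [norm_smul]
    have h₁ : ‖c j k‖ ≤ (1 / 2) ^ k := by
      simp only [c]
      split_ifs <;> simp
    calc ‖c j k‖ * ‖x k‖ ≤ (1 / 2) ^ k * 1 := by gcongr; exact hx k
      _ = _ := mul_one _
  have hy : ∀ i j, φ i (y j) = c j i := by
    intro i j
    rw [(φ i).map_tsum (hs j), tsum_eq_single i]
    · simp [hφx]
    · intro k hk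
      simp [hφx, hk.symm]
  set V := (⨅ k, (φ k).toLinearMap.ker) ⊔ R with hV
  let Y : (ℕ →₀ ℝ) →ₗ[ℝ] E := Finsupp.linearCombination ℝ y
  have hY : ∀ (a : ℕ →₀ ℝ) (k : ℕ), φ k (Y a) = a k.unpair.1 * (1 / 2) ^ k := by
    intro a k
    simp only [Y, Finsupp.linearCombination_apply, Finsupp.sum, map_sum, map_smul, hy, c,
      smul_eq_mul, mul_ite, mul_zero]
    rw [Finset.sum_ite_eq]
    split_ifs with hk
    · rfl
    · rw [Finsupp.notMem_support_iff.1 hk, zero_mul]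
  have hinj : Function.Injective (V.mkQ ∘ₗ Y) := by
    rw [← LinearMap.ker_eq_bot, LinearMap.ker_eq_bot']
    intro a ha
    have haV : Y a ∈ V := (Submodule.Quotient.mk_eq_zero V).1 ha
    obtain ⟨z, hz, r, hr, hzr⟩ := Submodule.mem_sup.1 haV
    obtain ⟨K, hK⟩ := hdecay r hr
    have hφz : ∀ k, φ k z = 0 := fun k => (Submodule.mem_iInf _).1 hz k
    ext j
    -- Along row `j`, `|a j| 2⁻ᵏ ≤ K 4⁻ᵏ` with `k = Nat.pair j m ≥ m`.
    have hbound : ∀ m, |a j| ≤ K * (1 / 2) ^ m := by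
      intro m
      have h₁ := hK (Nat.pair j m)
      have h₂ : φ (Nat.pair j m) r = a j * (1 / 2) ^ Nat.pair j m := by
        have := hY a (Nat.pair j m)
        rw [← hzr, map_add, hφz, zero_add, Nat.unpair_pair] at this
        exact this
      have h₃ : (1 / 4 : ℝ) ^ Nat.pair j m = (1 / 2) ^ Nat.pair j m * (1 / 2) ^ Nat.pair j m := by
        rw [← mul_pow]; norm_num
      rw [h₂, abs_mul, abs_of_pos (by positivity : (0 : ℝ) < (1 / 2) ^ Nat.pair j m), h₃,
        ← mul_assoc] at h₁
      have h₄ := le_of_mul_le_mul_right h₁ (by positivity)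
      have hK0 : 0 ≤ K := by simpa using (abs_nonneg _).trans (hK 0)
      refine h₄.trans (mul_le_mul_of_nonneg_left ?_ hK0)
      exact pow_le_pow_of_le_one (by norm_num) (by norm_num) (Nat.right_le_pair j m)
    have hlim : Tendsto (fun m : ℕ => K * (1 / 2 : ℝ) ^ m) atTop (𝓝 0) := by
      simpa using (tendsto_pow_atTop_nhds_zero_of_lt_one (by norm_num : (0 : ℝ) ≤ 1 / 2)
        (by norm_num)).const_mul K
    exact abs_nonpos_iff.1 (ge_of_tendsto' hlim hbound)
  have : Module.Finite ℝ (E ⧸ V) := hfin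
  have hfs : Module.Finite ℝ (ℕ →₀ ℝ) := Module.Finite.of_injective _ hinj
  exact not_finite_iff_infinite.2 inferInstance
    (Module.Finite.finite_basis (Finsupp.basisSingleOne (R := ℝ) (ι := ℕ)))

/-- Perturb the functionals `f j` by small multiples of the functionals `g n` so that each new
functional fails to vanish on infinitely many of the vectors `y n`. -/
theorem exists_perturbed_functionals {y : ℕ → E} {f g : ℕ → E →L[ℝ] ℝ}
    (hfx : ∀ i j, f i (x j) = if i = j then 1 else 0) (hfy : ∀ i j, f i (y j) = 0)
    (hgx : ∀ i j, g i (x j) = 0) (hgy : ∀ i j, g i (y j) = if i = j then 1 else 0)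
    (hg : ∀ i, ‖g i‖ ≤ 1) :
    ∃ φ : ℕ → E →L[ℝ] ℝ, (∀ i j, φ i (x j) = if i = j then 1 else 0) ∧
      (∀ j n, φ j (y n) = if n.unpair.1 = j then (1 / 8) ^ n else 0) ∧
      (∀ z, (∀ i, f i z = 0) → (∀ i, g i z = 0) → ∀ j, φ j z = 0) ∧
      ∀ j z, |φ j z| ≤ |f j z| + 2 * (1 / 4) ^ j * ‖z‖ := by
  -- `8⁻ⁿ = 2⁻ⁿ 4⁻ⁿ`: the first factor sums, the second is at most `4⁻ʲ` because `j ≤ n` on row `j`.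
  let c : ℕ → ℕ → ℝ := fun j n => if n.unpair.1 = j then (1 / 8) ^ n else 0
  have hc : ∀ j n, ‖c j n • g n‖ ≤ (1 / 2) ^ n * (1 / 4) ^ j := by
    intro j n
    rw [norm_smul]
    simp only [c]
    split_ifs with h
    · have hjn : j ≤ n := h ▸ Nat.unpair_left_le n
      have h₁ : (1 / 4 : ℝ) ^ n ≤ (1 / 4) ^ j :=
        pow_le_pow_of_le_one (by norm_num) (by norm_num) hjn
      calc ‖(1 / 8 : ℝ) ^ n‖ * ‖g n‖ ≤ (1 / 8) ^ n * 1 := by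
            rw [Real.norm_of_nonneg (by positivity)]
            gcongr
            exact hg n
        _ = (1 / 2) ^ n * (1 / 4) ^ n := by rw [mul_one, ← mul_pow]; norm_num
        _ ≤ _ := by gcongr
    · rw [norm_zero, zero_mul]
      positivity
  have hgeom : ∀ j : ℕ, HasSum (fun n : ℕ => (1 / 2 : ℝ) ^ n * (1 / 4) ^ j) (2 * (1 / 4) ^ j) :=
    fun j => hasSum_geometric_two.mul_right _
  have hs : ∀ j, Summable fun n => c j n • g n := fun j =>
    Summable.of_norm_bounded (hgeom j).summable (hc j)
  have happly : ∀ j z, (∑' n, c j n • g n) z = ∑' n, c j n * g n z := by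
    intro j z
    have := (ContinuousLinearMap.apply ℝ ℝ z).map_tsum (hs j)
    simpa using this
  refine ⟨fun j => f j + ∑' n, c j n • g n, ?_, ?_, ?_, ?_⟩
  · intro i j
    rw [add_apply, happly]
    simp [hfx, hgx]
  · intro j n
    rw [add_apply, happly, hfy, zero_add, tsum_eq_single n]
    · simp [hgy, c]
    · intro m hm
      simp [hgy, hm]
  · intro z hf hg' j
    rw [add_apply, happly]
    simp [hf, hg']
  · intro j z
    rw [add_apply]
    refine (abs_add_le _ _).trans (add_le_add le_rfl ?_)
    refine ((∑' n, c j n • g n).le_opNorm z).trans ?_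
    gcongr
    exact tsum_of_norm_bounded (hgeom j) (hc j)

end

/-! ### The subspace `E₁` -/

theorem theorem3p1 {E : Type u} {F : Type v}
    [NormedAddCommGroup E] [NormedSpace ℝ E] [CompleteSpace E]
    [NormedAddCommGroup F] [NormedSpace ℝ F] [CompleteSpace F]
    (L : Submodule ℝ E) (hL : IsClosed (L : Set E))
    (T : E →L[ℝ] F) (hT : HasKatoPropertyFor T L)
    (R : Submodule ℝ E) (hR : IsProperDenseOperatorRange R)
    (hLR : InfiniteCodim (L ⊔ R)) :
    ∃ E₁ : Submodule ℝ E, IsClosed (E₁ : Set E) ∧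
      L ≤ E₁ ∧
      (TopologicalSpace.SeparableSpace (E ⧸ E₁) ∧ InfiniteCodim E₁) ∧
      InfiniteCodim (E₁ ⊔ R) ∧
      closure (T '' (E₁ : Set E)) = closure (Set.range T) := by
  obtain ⟨G, _, _, _, A, hA⟩ := hR.isOperatorRange
  have hAR : A.toLinearMap.range = R := SetLike.coe_injective hA
  obtain ⟨x, y, f, g, hfL, hgL, hfx, hfy, hgx, hgy, hx, hfA, hg, hTy⟩ :=
    -- The rate `16⁻ⁿ` beats the factors `8ⁿ` that later multiply `T (y n)`.
    hT.exists_biorthogonal_sequences hL A (hAR ▸ hLR) (δ := fun n => (1 / 16) ^ n)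
      fun n => by positivity
  obtain ⟨φ, hφx, hφy, hφ0, hφ⟩ := exists_perturbed_functionals hfx hfy hgx hgy hg
  have hdecay : ∀ r ∈ R, ∃ K : ℝ, ∀ k, |φ k r| ≤ K * (1 / 4) ^ k := by
    intro r hr
    obtain ⟨z, rfl⟩ : r ∈ Set.range A := hA ▸ hr
    refine ⟨‖z‖ + 2 * ‖A z‖, fun k => (hφ k _).trans ?_⟩
    have h₁ : |f k (A z)| ≤ (1 / 4) ^ k * ‖z‖ :=
      calc |f k (A z)| ≤ ‖(f k).comp A‖ * ‖z‖ := ((f k).comp A).le_opNorm z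
        _ ≤ (1 / 16) ^ k * ‖z‖ := by gcongr; exact hfA k
        _ ≤ (1 / 4) ^ k * ‖z‖ := by gcongr; norm_num
    linarith
  have hsum : ∀ r ∈ R, Summable fun k => φ k r • x k := by
    intro r hr
    obtain ⟨K, hK⟩ := hdecay r hr
    refine Summable.of_norm_bounded
      ((summable_geometric_of_lt_one (by norm_num : (0 : ℝ) ≤ 1 / 4) (by norm_num)).mul_left K)
      fun k => ?_
    rw [norm_smul]
    calc ‖φ k r‖ * ‖x k‖ ≤ ‖φ k r‖ * 1 := by gcongr; exact hx k
      _ ≤ K * (1 / 4) ^ k := by rw [mul_one]; exact hK k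
  have hdense := dense_iInf_ker_sup_span hφx hR.dense hsum
  have hcodim := infiniteCodim_iInf_ker_sup hφx hx hdecay
  set E₁ : Submodule ℝ E := ⨅ k, (φ k).toLinearMap.ker with hE₁
  have hmem : ∀ {z}, z ∈ E₁ ↔ ∀ k, φ k z = 0 := by
    intro z
    simp [hE₁]
  refine ⟨E₁, ?_, fun l hl => hmem.2 (hφ0 l (fun i => hfL i l hl) fun i => hgL i l hl),
    ⟨separableSpace_quotient_of_dense_sup_span hdense, fun hfin => hcodim ?_⟩, hcodim, ?_⟩
  · have : (E₁ : Set E) = ⋂ k, {z | φ k z = 0} := by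
      ext z
      simp [hmem]
    rw [this]
    exact isClosed_iInter fun k => isClosed_eq (φ k).continuous continuous_const
  · have : FiniteDimensional ℝ (E ⧸ E₁) := hfin
    exact Module.Finite.of_surjective (Submodule.factor (le_sup_left : E₁ ≤ E₁ ⊔ R))
      (Submodule.factor_surjective _)
  · refine subset_antisymm (closure_mono (Set.image_subset_range _ _))
      (closure_minimal ?_ isClosed_closure)
    let N : Submodule ℝ F := (E₁.map T.toLinearMap).topologicalClosure
    have hN : (N : Set F) = closure (T '' (E₁ : Set E)) := by
      simp [N, Submodule.topologicalClosure_coe]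
    have hNclosed : IsClosed (N : Set F) := Submodule.isClosed_topologicalClosure _
    have hTx : ∀ j, T (x j) ∈ N := by
      intro j
      let m : ℕ → ℕ := fun n => Nat.pair j n
      have hker : ∀ n, x j - (8 : ℝ) ^ m n • y (m n) ∈ E₁ := by
        intro n
        refine hmem.2 fun k => ?_
        rw [map_sub, map_smul, hφx, hφy, Nat.unpair_pair, smul_eq_mul]
        rcases eq_or_ne k j with rfl | hkj
        · rw [if_pos rfl, if_pos rfl, ← mul_pow]
          norm_num
        · rw [if_neg hkj, if_neg hkj.symm, mul_zero, sub_zero]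
      have hlim : Tendsto (fun n => T (x j - (8 : ℝ) ^ m n • y (m n))) atTop (𝓝 (T (x j))) := by
        have h₀ : Tendsto (fun n => (8 : ℝ) ^ m n • T (y (m n))) atTop (𝓝 0) := by
          refine squeeze_zero_norm (a := fun n => (1 / 2 : ℝ) ^ n) (fun n => ?_)
            (tendsto_pow_atTop_nhds_zero_of_lt_one (by norm_num) (by norm_num))
          rw [norm_smul, Real.norm_of_nonneg (by positivity)]
          calc (8 : ℝ) ^ m n * ‖T (y (m n))‖ ≤ 8 ^ m n * (1 / 16) ^ m n := by
                gcongr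
                exact hTy _
            _ = (1 / 2) ^ m n := by rw [← mul_pow]; norm_num
            _ ≤ (1 / 2) ^ n :=
                pow_le_pow_of_le_one (by norm_num) (by norm_num) (Nat.right_le_pair j n)
        simpa using h₀.const_sub (T (x j))
      exact hNclosed.mem_of_tendsto hlim (Eventually.of_forall fun n =>
        Submodule.le_topologicalClosure _ (Submodule.mem_map_of_mem (hker n)))
    have hle : E₁ ⊔ Submodule.span ℝ (Set.range x) ≤ N.comap T.toLinearMap := by
      refine sup_le (fun z hz => Submodule.le_topologicalClosure _ (Submodule.mem_map_of_mem hz))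
        (Submodule.span_le.2 ?_)
      rintro _ ⟨j, rfl⟩
      exact hTx j
    rintro _ ⟨z, rfl⟩
    rw [← hN]
    exact closure_minimal (fun w hw => hle hw) (hNclosed.preimage T.continuous) (hdense z)
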